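/- **Theorem (Clarke chain rule for two-layer ReLU networks).** Let $\ell:\mathbb{R}\times\mathbb{R}\to\mathbb{R}$ be differentiable with locally Lipschitz gradient, let $(x_i,y_i)\in\mathbb{R}^d\times\mathbb{R}$, $i=1,\dots,N$, be data with $x_i\neq 0$ for all $i$, and consider the empirical loss $$L(u_1,w_1,\dots,u_H,w_H)=\sum_{i=1}^N \ell\Big(\sum_{k=1}^H u_k\max\{w_k^\top x_i,0\},\,y_i\Big),\qquad u_k\in\mathbb{R},\ w_k\in\mathbb{R}^d .$$ For a locally Lipschitz function $f$ on a Euclidean space, its Clarke subdifferential $\partial_C f(a)$ is the convex hull of the set of all limits $\lim_n\nabla f(a_n)$ along sequences $a_n\to a$ of points at which $f$ is differentiable. Fix a point $(u_1,w_1,\dots,u_H,w_H)$. With $\ell_i=\ell(\cdot,y_i)$ put $\rho_i=\ell_i'\big(\sum_{k=1}^H u_k\max\{w_k^\top x_i,0\}\big)$ and, for each $k$, $$I_k^+=\{i: w_k^\top x_i=0,\ u_k\rho_i>0\},\qquad I_k^-=\{i: w_k^\top x_i=0,\ u_k\rho_i<0\},$$ $$G_k^C=\sum_{i:\,w_k^\top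 x_i\neq 0}u_k\rho_i\,\mathbf 1_{w_k^\top x_i>0}\,x_i+\sum_{j:\,w_k^\top x_j=0}u_k\rho_j\,x_j\cdot[0,1]\subseteq\mathbb{R}^d,$$ where sums of sets are Minkowski sums. Then $$\partial_C L(u_1,w_1,\dots,u_H,w_H)=\prod_{k=1}^H\Big\{\sum_{i=1}^N\rho_i\max\{w_k^\top x_i,0\}\Big\}\times G_k^C$$ if and only if the following Span Qualification holds: for every $k\in\{1,\dots,H\}$, $$\operatorname{span}\{x_i: i\in I_k^+\}\cap\operatorname{span}\{x_j: j\in I_k^-\}=\{0\}.$$ -/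

import Mathlib

open Set Filter Topology
open scoped Pointwise BigOperators

noncomputable section

/-- The Clarke subdifferential of a (locally Lipschitz) function `f` on a Euclidean space at `a`:
the convex hull of all limits of gradients `∇ f (zₙ)` along sequences `zₙ → a` of points at which
`f` is differentiable. -/
def clarkeSubdifferential {E : Type*} [NormedAddCommGroup E] [InnerProductSpace ℝ E]
    [CompleteSpace E] (f : E → ℝ) (a : E) : Set E :=
  convexHull ℝ {s : E | ∃ z : ℕ → E, Tendsto z atTop (𝓝 a) ∧
    (∀ n, DifferentiableAt ℝ f (z n)) ∧ Tendsto (fun n => gradient f (z n)) atTop (𝓝 s)}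

namespace TwoLayerReLU

/-- The parameter space of tuples `(u₁, w₁, …, u_H, w_H)` with `u_k ∈ ℝ` and `w_k ∈ ℝᵈ`, with the
Euclidean inner product of `ℝ^(H(1+d))`. -/
abbrev Params (H d : ℕ) : Type :=
  PiLp 2 (fun _ : Fin H => WithLp 2 (ℝ × EuclideanSpace ℝ (Fin d)))

variable {N H d : ℕ}

/-- The outer weight `u_k`. -/
def u (θ : Params H d) (k : Fin H) : ℝ := (θ k).fst

/-- The inner weight vector `w_k`. -/
def w (θ : Params H d) (k : Fin H) : EuclideanSpace ℝ (Fin d) := (θ k).snd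

/-- The output `∑ₖ u_k max {w_kᵀ a, 0}` of the network at the input `a`. -/
def output (θ : Params H d) (a : EuclideanSpace ℝ (Fin d)) : ℝ :=
  ∑ k, u θ k * max (inner ℝ (w θ k) a) 0

/-- The empirical loss `L(θ) = ∑ᵢ ℓ(∑ₖ u_k max {w_kᵀ xᵢ, 0}, yᵢ)`. -/
def empiricalLoss (ℓ : ℝ × ℝ → ℝ) (x : Fin N → EuclideanSpace ℝ (Fin d)) (y : Fin N → ℝ)
    (θ : Params H d) : ℝ :=
  ∑ i, ℓ (output θ (x i), y i)

/-- `ρᵢ = ℓᵢ'(∑ₖ u_k max {w_kᵀ xᵢ, 0})` where `ℓᵢ = ℓ(·, yᵢ)`. -/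
def rho (ℓ : ℝ × ℝ → ℝ) (x : Fin N → EuclideanSpace ℝ (Fin d)) (y : Fin N → ℝ)
    (θ : Params H d) (i : Fin N) : ℝ :=
  deriv (fun t => ℓ (t, y i)) (output θ (x i))

/-- The indices `i` with `w_kᵀ xᵢ = 0` and `u_k ρᵢ > 0`. -/
def indexPos (ℓ : ℝ × ℝ → ℝ) (x : Fin N → EuclideanSpace ℝ (Fin d)) (y : Fin N → ℝ)
    (θ : Params H d) (k : Fin H) : Set (Fin N) :=
  {i | inner ℝ (w θ k) (x i) = 0 ∧ 0 < u θ k * rho ℓ x y θ i}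

/-- The indices `i` with `w_kᵀ xᵢ = 0` and `u_k ρᵢ < 0`. -/
def indexNeg (ℓ : ℝ × ℝ → ℝ) (x : Fin N → EuclideanSpace ℝ (Fin d)) (y : Fin N → ℝ)
    (θ : Params H d) (k : Fin H) : Set (Fin N) :=
  {i | inner ℝ (w θ k) (x i) = 0 ∧ u θ k * rho ℓ x y θ i < 0}

open Classical in
/-- The set `G_k^C`: the vector `∑ u_k ρᵢ 𝟏[w_kᵀ xᵢ > 0] xᵢ` over the `i` with `w_kᵀ xᵢ ≠ 0`, plus
the Minkowski sum of the sets `u_k ρⱼ xⱼ · [0,1]` over the `j` with `w_kᵀ xⱼ = 0`. -/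
def GC (ℓ : ℝ × ℝ → ℝ) (x : Fin N → EuclideanSpace ℝ (Fin d)) (y : Fin N → ℝ)
    (θ : Params H d) (k : Fin H) : Set (EuclideanSpace ℝ (Fin d)) :=
  {∑ i with inner ℝ (w θ k) (x i) ≠ 0,
      (u θ k * rho ℓ x y θ i * (if 0 < inner ℝ (w θ k) (x i) then 1 else 0)) • x i} +
    ∑ j with inner ℝ (w θ k) (x j) = 0,
      (fun t : ℝ => t • ((u θ k * rho ℓ x y θ j) • x j)) '' Icc (0 : ℝ) 1

/-- The set `∏ₖ {∑ᵢ ρᵢ max {w_kᵀ xᵢ, 0}} × G_k^C` of tuples in the parameter space. -/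
def chainRuleSet (ℓ : ℝ × ℝ → ℝ) (x : Fin N → EuclideanSpace ℝ (Fin d)) (y : Fin N → ℝ)
    (θ : Params H d) : Set (Params H d) :=
  {g | ∀ k, u g k = ∑ i, rho ℓ x y θ i * max (inner ℝ (w θ k) (x i)) 0 ∧
    w g k ∈ GC ℓ x y θ k}

/-- Span Qualification: for each `k`, the spans of `{xᵢ : w_kᵀ xᵢ = 0, u_k ρᵢ > 0}` and of
`{xⱼ : w_kᵀ xⱼ = 0, u_k ρⱼ < 0}` meet only in `0`. -/
def SpanQualification (ℓ : ℝ × ℝ → ℝ) (x : Fin N → EuclideanSpace ℝ (Fin d)) (y : Fin N → ℝ)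
    (θ : Params H d) : Prop :=
  ∀ k : Fin H, Submodule.span ℝ (x '' indexPos ℓ x y θ k) ⊓
    Submodule.span ℝ (x '' indexNeg ℓ x y θ k) = ⊥

end TwoLayerReLU

end

/-! The hyperplanes `w_kᵀ xᵢ = 0` cut parameter space into finitely many cells, on each of which the
loss agrees with a differentiable loss with frozen 0-1 gates. Hence the limiting gradients at θ are
the gated vectors whose gates at the kinks (`w_kᵀ xᵢ = 0`) are the signs of `v_kᵀ xᵢ` for generic
`v` (`exists_tendsto_gradient_iff`). A differentiability point on a cell boundary adds nothing,
because the gradient is determined by any full-dimensional convex cell containing it. The chain rule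
set has the same form, but with arbitrary gates in `[0,1]` at the kinks, so it always contains the
Clarke subdifferential.

Equality is decided by support functions. In direction δ the best gate at a kink is 1 when `u_k ρᵢ
δ_kᵀ xᵢ > 0` and 0 when it is negative. Realizing it by a limiting gradient requires a vector with
the signs of `δ_k` on `I_k⁺` and the opposite signs on `I_k⁻`. Such a sign flip exists for every
`δ_k` exactly when the two spans meet trivially: orthogonal complements give one direction
(`exists_inner_eq_and_inner_eq_neg`), and a basis adapted to both families gives the other
(`span_inf_span_eq_bot_of_exists_sign_flip`). -/

section SignedVectors

/-! ### Sign flips and spans that meet trivially -/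

variable {V : Type*} [NormedAddCommGroup V] [InnerProductSpace ℝ V] [FiniteDimensional ℝ V]

/-- Every linear functional on a finite-dimensional inner product space is an inner product. -/
theorem exists_inner_eq_dual (f : V →ₗ[ℝ] ℝ) : ∃ v : V, ∀ x, inner ℝ v x = f x := by
  have : CompleteSpace V := FiniteDimensional.complete ℝ V
  exact ⟨(InnerProductSpace.toDual ℝ V).symm (LinearMap.toContinuousLinearMap f), fun x => by simp⟩

/-- Finitely many nonzero vectors admit a vector orthogonal to none of them. -/
theorem exists_forall_inner_ne_zero {ι : Type*} [Finite ι] (x : ι → V) (hx : ∀ i, x i ≠ 0) :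
    ∃ v : V, ∀ i, inner ℝ v (x i) ≠ 0 := by
  obtain ⟨f, hf⟩ := Module.exists_dual_forall_apply_ne_zero (K := ℝ) x hx
  obtain ⟨v, hv⟩ := exists_inner_eq_dual f
  exact ⟨v, fun i => by rw [hv]; exact hf i⟩

/-- If the spans of `P` and `Q` meet trivially, every vector can be replaced by one with the same
inner products on `P` and the opposite inner products on `Q`. -/
theorem exists_inner_eq_and_inner_eq_neg {P Q : Set V}
    (h : Submodule.span ℝ P ⊓ Submodule.span ℝ Q = ⊥) (v : V) :
    ∃ v' : V, (∀ p ∈ P, inner ℝ v' p = inner ℝ v p) ∧ ∀ q ∈ Q, inner ℝ v' q = -inner ℝ v q := by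
  -- Dually, the orthogonal complements span everything: `v = a + b` with `a ⊥ P` and `b ⊥ Q`, and
  -- `b - a` is the required vector.
  have htop : (Submodule.span ℝ P)ᗮ ⊔ (Submodule.span ℝ Q)ᗮ = ⊤ := by
    rw [← Submodule.orthogonal_eq_bot_iff, ← Submodule.inf_orthogonal,
      Submodule.orthogonal_orthogonal, Submodule.orthogonal_orthogonal, h]
  obtain ⟨a, ha, b, hb, rfl⟩ := Submodule.mem_sup.1 (htop ▸ Submodule.mem_top (x := v))
  refine ⟨b - a, fun p hp => ?_, fun q hq => ?_⟩
  · have : inner ℝ a p = (0 : ℝ) := Submodule.inner_left_of_mem_orthogonal (Submodule.subset_span hp) ha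
    rw [inner_sub_left, inner_add_left, this]; ring
  · have : inner ℝ b q = (0 : ℝ) := Submodule.inner_left_of_mem_orthogonal (Submodule.subset_span hq) hb
    rw [inner_sub_left, inner_add_left, this]; ring

/-- Perturbation of a vector that makes all inner products with a finite family of nonzero vectors
nonzero while keeping the strict signs. -/
theorem exists_generic_same_sign {ι : Type*} [Finite ι] (x : ι → V) (hx : ∀ i, x i ≠ 0) (v : V) :
    ∃ v' : V, ∀ i, inner ℝ v' (x i) ≠ 0 ∧ (0 < inner ℝ v (x i) → 0 < inner ℝ v' (x i)) ∧
      (inner ℝ v (x i) < 0 → inner ℝ v' (x i) < 0) := by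
  obtain ⟨z, hz⟩ := exists_forall_inner_ne_zero x hx
  have key : ∀ i, ∀ᶠ t : ℝ in 𝓝[>] 0, inner ℝ (v + t • z) (x i) ≠ 0 ∧
      (0 < inner ℝ v (x i) → 0 < inner ℝ (v + t • z) (x i)) ∧
      (inner ℝ v (x i) < 0 → inner ℝ (v + t • z) (x i) < 0) := by
    intro i
    have hc : Tendsto (fun t : ℝ => (inner ℝ (v + t • z) (x i) : ℝ)) (𝓝[>] 0)
        (𝓝 (inner ℝ v (x i))) := by
      have : Continuous (fun t : ℝ => (inner ℝ (v + t • z) (x i) : ℝ)) := by fun_prop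
      simpa using (this.tendsto 0).mono_left nhdsWithin_le_nhds
    rcases lt_trichotomy (inner ℝ v (x i) : ℝ) 0 with h | h | h
    · filter_upwards [hc.eventually_lt_const h] with t ht
      exact ⟨ht.ne, fun h' => absurd h' h.not_gt, fun _ => ht⟩
    · filter_upwards [self_mem_nhdsWithin] with t ht
      refine ⟨?_, fun h' => absurd h' h.not_gt, fun h' => absurd h' h.not_lt⟩
      rw [inner_add_left, h, inner_smul_left, zero_add]
      exact mul_ne_zero (by simpa using (ne_of_gt ht)) (hz i)
    · filter_upwards [hc.eventually_const_lt h] with t ht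
      exact ⟨ht.ne', fun _ => ht, fun h' => absurd h' h.not_gt⟩
  obtain ⟨t, ht⟩ := (eventually_all.2 key).exists
  exact ⟨v + t • z, ht⟩

/-- If every vector can be replaced by one with the same strict signs on `P` and the opposite
strict signs on `Q`, then the spans of `P` and `Q` meet trivially. -/
theorem span_inf_span_eq_bot_of_exists_sign_flip {P Q : Set V}
    (h : ∀ v : V, ∃ v' : V,
      (∀ p ∈ P, (0 < inner ℝ v p → 0 ≤ inner ℝ v' p) ∧ (inner ℝ v p < 0 → inner ℝ v' p ≤ 0)) ∧
      ∀ q ∈ Q, (0 < inner ℝ v q → inner ℝ v' q < 0) ∧ (inner ℝ v q < 0 → 0 < inner ℝ v' q)) :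
    Submodule.span ℝ P ⊓ Submodule.span ℝ Q = ⊥ := by
  classical
  -- `B ⊆ P` is a basis of the span of `P`, and `C` extends it by vectors of `Q` to a basis of the
  -- span of `P ∪ Q`. It suffices that no `q ∈ Q` has a component along `B`.
  obtain ⟨B, hBP, -, hPB, hB⟩ := exists_linearIndepOn_id_extension
    (linearIndepOn_empty ℝ (id : V → V)) (empty_subset P)
  obtain ⟨C, hCQ, hBC, hQC, hC⟩ := exists_linearIndepOn_id_extension hB
    (subset_union_left (t := Q))
  have hC' : LinearIndependent ℝ ((↑) : C → V) := hC
  have : Finite C := hC'.finite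
  have : Fintype C := Fintype.ofFinite C
  have hmem : ∀ c : C, (c : V) ∉ B → (c : V) ∈ Q := fun c hc => (hCQ c.2).resolve_left hc
  have hQ : ∀ q ∈ Q, q ∈ Submodule.span ℝ (C \ B) := by
    intro q hq
    obtain ⟨l, hl⟩ : ∃ l : C → ℝ, ∑ c, l c • (c : V) = q := by
      have := hQC (Or.inr hq)
      rw [SetLike.mem_coe, ← Subtype.range_coe (s := C)] at this
      exact (Submodule.mem_span_range_iff_exists_fun ℝ).1 this
    have hlB : ∀ c : C, (c : V) ∈ B → l c = 0 := by
      by_contra! hne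
      obtain ⟨c₀, hc₀, hl₀⟩ := hne
      -- With weight `K` the single term at `c₀` outweighs all negative terms coming from outside
      -- `B`, so `v` below is positive on `q`. Flipping signs off `B` makes every term of `inner ℝ
      -- v' q` nonnegative, whereas `q ∈ Q` demands a negative value.
      obtain ⟨K, hK0, hK⟩ : ∃ K : ℝ, 0 < K ∧ ∑ c, l c ^ 2 < K * l c₀ ^ 2 := by
        have h0 : 0 < l c₀ ^ 2 := by positivity
        refine ⟨(∑ c, l c ^ 2 + 1) / l c₀ ^ 2, by positivity, ?_⟩
        rw [div_mul_cancel₀ _ h0.ne']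
        linarith
      obtain ⟨v, hv⟩ : ∃ v : V, ∀ c : C,
          inner ℝ v (c : V) = if (c : V) ∈ B then K * l c else -l c := by
        -- Independence of `C` lets the inner products be prescribed freely; the value 0 on the
        -- remaining basis vectors is arbitrary.
        let b := Module.Basis.extend hC
        obtain ⟨v, hv⟩ := exists_inner_eq_dual
          (b.constr ℝ fun i => if h : (i : V) ∈ C then
            (if (i : V) ∈ B then K * l ⟨i, h⟩ else -l ⟨i, h⟩) else 0)
        refine ⟨v, fun c => ?_⟩
        have hb : b ⟨c, hC.subset_extend (subset_univ _) c.2⟩ = (c : V) :=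
          Module.Basis.extend_apply_self hC _
        rw [hv]
        conv_lhs => rw [← hb]
        rw [Module.Basis.constr_basis]
        simp
      obtain ⟨v', hP', hQ'⟩ := h v
      have hqv : 0 < inner ℝ v q := by
        rw [← hl, inner_sum]
        have h1 : ∀ c, inner ℝ v (l c • (c : V)) ≥ (if c = c₀ then K * l c₀ ^ 2 else 0) - l c ^ 2 := by
          intro c
          rw [inner_smul_right, hv]
          by_cases hc : c = c₀
          · subst hc
            simp only [hc₀, if_true]
            nlinarith [sq_nonneg (l c)]
          · simp only [hc, if_false]
            split_ifs
            · nlinarith [mul_nonneg hK0.le (sq_nonneg (l c)), sq_nonneg (l c)]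
            · nlinarith
        have h2 := Finset.sum_le_sum fun c (_ : c ∈ Finset.univ) => h1 c
        rw [Finset.sum_sub_distrib, Finset.sum_ite_eq' Finset.univ c₀] at h2
        simp only [Finset.mem_univ, if_true] at h2
        linarith
      have hqv' : 0 ≤ inner ℝ v' q := by
        rw [← hl, inner_sum]
        refine Finset.sum_nonneg fun c _ => ?_
        rw [inner_smul_right]
        have hvc := hv c
        by_cases hc : (c : V) ∈ B
        · rw [if_pos hc] at hvc
          obtain ⟨h1, h2⟩ := hP' _ (hBP hc)
          rcases lt_trichotomy (l c) 0 with hlc | hlc | hlc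
          · exact mul_nonneg_of_nonpos_of_nonpos hlc.le
              (h2 (hvc ▸ mul_neg_of_pos_of_neg hK0 hlc))
          · simp [hlc]
          · exact mul_nonneg hlc.le (h1 (hvc ▸ mul_pos hK0 hlc))
        · rw [if_neg hc] at hvc
          obtain ⟨h1, h2⟩ := hQ' _ (hmem c hc)
          rcases lt_trichotomy (l c) 0 with hlc | hlc | hlc
          · exact mul_nonneg_of_nonpos_of_nonpos hlc.le (h1 (by linarith)).le
          · simp [hlc]
          · exact mul_nonneg hlc.le (h2 (by linarith)).le
      exact absurd ((hQ' q hq).1 hqv) hqv'.not_gt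
    rw [← hl]
    refine Submodule.sum_mem _ fun c _ => ?_
    by_cases hc : (c : V) ∈ B
    · simp [hlB c hc]
    · exact Submodule.smul_mem _ _ (Submodule.subset_span ⟨c.2, hc⟩)
  have hdisj : Disjoint (Submodule.span ℝ B) (Submodule.span ℝ (C \ B)) := by
    have := hC'.disjoint_span_image (s := {c | (c : V) ∈ B}) (t := {c | (c : V) ∉ B})
      (disjoint_left.2 fun c h1 h2 => h2 h1)
    convert this using 2
    · ext z
      exact ⟨fun hz => ⟨⟨z, hBC hz⟩, hz, rfl⟩, by rintro ⟨c, hc, rfl⟩; exact hc⟩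
    · ext z
      exact ⟨fun hz => ⟨⟨z, hz.1⟩, hz.2, rfl⟩, by rintro ⟨c, hc, rfl⟩; exact ⟨c.2, hc⟩⟩
  exact (hdisj.mono (Submodule.span_le.2 hPB) (Submodule.span_le.2 hQ)).eq_bot

end SignedVectors

/-! ### Gradients on convex sets, cells and limiting gradients -/

noncomputable section

/-- Functions that agree on a convex set with nonempty interior have the same gradient at each
point of the set at which both are differentiable. -/
theorem HasGradientAt.eq_of_eqOn_convex {F : Type*} [NormedAddCommGroup F]
    [InnerProductSpace ℝ F] [CompleteSpace F] {f g : F → ℝ} {f' g' a : F} {s : Set F}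
    (hf : HasGradientAt f f' a) (hg : HasGradientAt g g' a) (hs : Convex ℝ s)
    (hs' : (interior s).Nonempty) (ha : a ∈ s) (h : EqOn f g s) : f' = g' := by
  -- Derivatives within a convex set with nonempty interior are unique even at its boundary points.
  have h1 := (hasGradientAt_iff_hasFDerivAt.1 hf).hasFDerivWithinAt (s := s)
  have h2 := (hasGradientAt_iff_hasFDerivAt.1 hg).hasFDerivWithinAt (s := s)
  exact (InnerProductSpace.toDual ℝ F).injective
    ((uniqueDiffWithinAt_convex hs hs' (subset_closure ha)).eq h1 (h2.congr h (h ha)))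

namespace TwoLayerReLU

variable {N H d : ℕ}

/-- The outer weight as a continuous linear functional on the parameter space. -/
def uCLM (k : Fin H) : Params H d →L[ℝ] ℝ :=
  (WithLp.fstL 2 ℝ ℝ (EuclideanSpace ℝ (Fin d))).comp
    (PiLp.proj 2 (fun _ : Fin H => WithLp 2 (ℝ × EuclideanSpace ℝ (Fin d))) k)

/-- The inner weight vector as a continuous linear map on the parameter space. -/
def wCLM (k : Fin H) : Params H d →L[ℝ] EuclideanSpace ℝ (Fin d) :=
  (WithLp.sndL 2 ℝ ℝ (EuclideanSpace ℝ (Fin d))).comp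
    (PiLp.proj 2 (fun _ : Fin H => WithLp 2 (ℝ × EuclideanSpace ℝ (Fin d))) k)

theorem uCLM_apply (k : Fin H) (θ : Params H d) : uCLM k θ = u θ k := rfl

theorem wCLM_apply (k : Fin H) (θ : Params H d) : wCLM k θ = w θ k := rfl

/-- The parameter tuple with given outer and inner weights. -/
def mk (a : Fin H → ℝ) (b : Fin H → EuclideanSpace ℝ (Fin d)) : Params H d :=
  WithLp.toLp 2 fun k => WithLp.toLp 2 (a k, b k)

@[simp] theorem u_mk (a : Fin H → ℝ) (b : Fin H → EuclideanSpace ℝ (Fin d)) (k : Fin H) :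
    u (mk a b) k = a k := rfl

@[simp] theorem w_mk (a : Fin H → ℝ) (b : Fin H → EuclideanSpace ℝ (Fin d)) (k : Fin H) :
    w (mk a b) k = b k := rfl

theorem params_ext {θ η : Params H d} (hu : ∀ k, u θ k = u η k) (hw : ∀ k, w θ k = w η k) :
    θ = η := by
  refine PiLp.ext fun k => ?_
  exact WithLp.ofLp_injective 2 (Prod.ext (hu k) (hw k))

theorem inner_params (θ η : Params H d) :
    inner ℝ θ η = ∑ k, (u θ k * u η k + inner ℝ (w θ k) (w η k)) := by
  rw [PiLp.inner_apply]
  refine Finset.sum_congr rfl fun k _ => ?_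
  rw [WithLp.prod_inner_apply]
  congr 1
  exact mul_comm _ _

theorem w_add (θ η : Params H d) (k : Fin H) : w (θ + η) k = w θ k + w η k := rfl

theorem u_add (θ η : Params H d) (k : Fin H) : u (θ + η) k = u θ k + u η k := rfl

theorem w_smul (t : ℝ) (θ : Params H d) (k : Fin H) : w (t • θ) k = t • w θ k := rfl

theorem u_smul (t : ℝ) (θ : Params H d) (k : Fin H) : u (t • θ) k = t * u θ k := rfl

@[fun_prop] theorem continuous_u (k : Fin H) : Continuous fun θ : Params H d => u θ k :=
  (uCLM k).continuous

@[fun_prop] theorem continuous_w (k : Fin H) : Continuous fun θ : Params H d => w θ k :=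
  (wCLM k).continuous

theorem continuous_mk {X : Type*} [TopologicalSpace X] {a : X → Fin H → ℝ}
    {b : X → Fin H → EuclideanSpace ℝ (Fin d)} (ha : ∀ k, Continuous fun z => a z k)
    (hb : ∀ k, Continuous fun z => b z k) : Continuous fun z => mk (a z) (b z) :=
  (PiLp.continuous_toLp 2 _).comp (continuous_pi fun k =>
    (WithLp.prod_continuous_toLp 2 _ _).comp ((ha k).prodMk (hb k)))

variable {ℓ : ℝ × ℝ → ℝ} {x : Fin N → EuclideanSpace ℝ (Fin d)} {y : Fin N → ℝ}

/-- The set of parameters whose pre-activations are nonnegative on `e` and nonpositive off `e`. -/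
def cell (x : Fin N → EuclideanSpace ℝ (Fin d)) (e : Fin H → Set (Fin N)) : Set (Params H d) :=
  {η | ∀ k i, (i ∈ e k → 0 ≤ inner ℝ (w η k) (x i)) ∧ (i ∉ e k → inner ℝ (w η k) (x i) ≤ 0)}

/-- The set of parameters whose pre-activations are positive on `e` and negative off `e`. -/
def openCell (x : Fin N → EuclideanSpace ℝ (Fin d)) (e : Fin H → Set (Fin N)) :
    Set (Params H d) :=
  {η | ∀ k i, (i ∈ e k → 0 < inner ℝ (w η k) (x i)) ∧ (i ∉ e k → inner ℝ (w η k) (x i) < 0)}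

theorem openCell_subset_cell (e : Fin H → Set (Fin N)) :
    openCell (d := d) x e ⊆ cell x e :=
  fun _ h k i => ⟨fun hi => ((h k i).1 hi).le, fun hi => ((h k i).2 hi).le⟩

theorem isOpen_openCell (e : Fin H → Set (Fin N)) : IsOpen (openCell (d := d) x e) := by
  simp only [openCell, ofPred_forall, ofPred_and]
  refine isOpen_iInter_of_finite fun k => isOpen_iInter_of_finite fun i => ?_
  by_cases hi : i ∈ e k
  · simpa [hi] using isOpen_lt continuous_const ((continuous_w k).inner continuous_const)
  · simpa [hi] using isOpen_lt ((continuous_w k).inner continuous_const) continuous_const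

theorem convex_cell (e : Fin H → Set (Fin N)) : Convex ℝ (cell (d := d) x e) := by
  intro η hη ξ hξ a b ha hb _ k i
  rw [w_add, w_smul, w_smul, inner_add_left, inner_smul_left, inner_smul_left]
  simp only [conj_trivial]
  refine ⟨fun hi => ?_, fun hi => ?_⟩
  · exact add_nonneg (mul_nonneg ha ((hη k i).1 hi)) (mul_nonneg hb ((hξ k i).1 hi))
  · exact add_nonpos (mul_nonpos_of_nonneg_of_nonpos ha ((hη k i).2 hi))
      (mul_nonpos_of_nonneg_of_nonpos hb ((hξ k i).2 hi))

/-- For each neuron, the set of inputs that are active at `θ` infinitesimally in the direction `v`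
of the inner weights. -/
def activeSet (x : Fin N → EuclideanSpace ℝ (Fin d)) (θ : Params H d)
    (v : Fin H → EuclideanSpace ℝ (Fin d)) (k : Fin H) : Set (Fin N) :=
  {i | 0 < inner ℝ (w θ k) (x i) ∨ inner ℝ (w θ k) (x i) = 0 ∧ 0 < inner ℝ (v k) (x i)}

theorem mem_cell_activeSet (θ : Params H d) (v : Fin H → EuclideanSpace ℝ (Fin d)) :
    θ ∈ cell x (activeSet x θ v) := by
  intro k i
  simp only [activeSet, mem_ofPred_eq]
  refine ⟨fun h => h.elim le_of_lt fun h => h.1.ge, fun h => ?_⟩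
  exact not_lt.1 fun hpos => h (Or.inl hpos)

/-- Moving a little along a generic direction enters the open cell of the active set. -/
theorem eventually_mem_openCell (θ : Params H d) {v : Fin H → EuclideanSpace ℝ (Fin d)}
    (hv : ∀ k i, inner ℝ (v k) (x i) ≠ 0) :
    ∀ᶠ t : ℝ in 𝓝[>] 0, θ + t • mk 0 v ∈ openCell x (activeSet x θ v) := by
  simp only [openCell, mem_ofPred_eq, eventually_all]
  intro k i
  have hc : Tendsto (fun t : ℝ => (inner ℝ (w (θ + t • mk 0 v) k) (x i) : ℝ)) (𝓝[>] 0)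
      (𝓝 (inner ℝ (w θ k) (x i))) := by
    have : Continuous (fun t : ℝ => (inner ℝ (w (θ + t • mk 0 v) k) (x i) : ℝ)) := by fun_prop
    simpa using (this.tendsto 0).mono_left nhdsWithin_le_nhds
  rcases lt_trichotomy (inner ℝ (w θ k) (x i) : ℝ) 0 with h | h | h
  · filter_upwards [hc.eventually_lt_const h] with t ht
    refine ⟨fun hi => ?_, fun _ => ht⟩
    rcases hi with hi | hi
    · exact absurd hi h.not_gt
    · exact absurd hi.1 h.ne
  · filter_upwards [self_mem_nhdsWithin] with t ht
    have ht : 0 < t := ht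
    have he : inner ℝ (w (θ + t • mk 0 v) k) (x i) = t * inner ℝ (v k) (x i) := by
      rw [w_add, w_smul, w_mk, inner_add_left, inner_smul_left, h]; simp
    rw [he]
    refine ⟨fun hi => ?_, fun hi => ?_⟩
    · rcases hi with hi | hi
      · exact absurd hi h.not_gt
      · exact mul_pos ht hi.2
    · refine mul_neg_of_pos_of_neg ht (lt_of_le_of_ne (not_lt.1 fun h' => hi ?_) (hv k i))
      exact Or.inr ⟨h, h'⟩
  · filter_upwards [hc.eventually_const_lt h] with t ht
    exact ⟨fun _ => ht, fun hi => absurd (Or.inl h) hi⟩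

/-- Near `θ`, an open cell that contains `η` is the cell of the active set at `θ` in the direction
of the inner weights of `η`. -/
theorem eventually_eq_activeSet (θ : Params H d) :
    ∀ᶠ η in 𝓝 θ, ∀ e : Fin H → Set (Fin N), η ∈ openCell x e →
      e = activeSet x θ (w η) ∧ ∀ k i, inner ℝ (w η k) (x i) ≠ 0 := by
  -- Strict signs at θ persist nearby, so only the kinks of θ are left for `w η` to decide.
  have key : ∀ᶠ η in 𝓝 θ, ∀ k i, (0 < inner ℝ (w θ k) (x i) → 0 < inner ℝ (w η k) (x i)) ∧
      (inner ℝ (w θ k) (x i) < 0 → inner ℝ (w η k) (x i) < 0) := by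
    simp only [eventually_all]
    intro k i
    have hc : Continuous fun η : Params H d => (inner ℝ (w η k) (x i) : ℝ) := by fun_prop
    rcases lt_trichotomy (inner ℝ (w θ k) (x i) : ℝ) 0 with h | h | h
    · filter_upwards [(hc.tendsto θ).eventually_lt_const h] with η hη
      exact ⟨fun h' => absurd h h'.not_gt, fun _ => hη⟩
    · exact Eventually.of_forall fun η => ⟨fun h' => absurd h h'.ne', fun h' => absurd h h'.ne⟩
    · filter_upwards [(hc.tendsto θ).eventually_const_lt h] with η hη
      exact ⟨fun _ => hη, fun h' => absurd h h'.not_gt⟩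
  filter_upwards [key] with η hη e he
  refine ⟨?_, fun k i => ?_⟩
  · ext k i
    constructor
    · intro hi
      have h1 := (he k i).1 hi
      rcases lt_trichotomy (inner ℝ (w θ k) (x i) : ℝ) 0 with h | h | h
      · exact absurd h1 ((hη k i).2 h).not_gt
      · exact Or.inr ⟨h, h1⟩
      · exact Or.inl h
    · intro hi
      by_contra hne
      have h1 := (he k i).2 hne
      rcases hi with hi | hi
      · exact absurd h1 ((hη k i).1 hi).not_gt
      · exact absurd h1 hi.2.not_gt
  · by_cases hi : i ∈ e k
    · exact ne_of_gt ((he k i).1 hi)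
    · exact ((he k i).2 hi).ne

/-- The tuple of vectors `(∑ᵢ ρᵢ max {w_kᵀ xᵢ, 0}, ∑ᵢ u_k ρᵢ tₖᵢ xᵢ)` for given gate values `t`. -/
def gatedVector (ℓ : ℝ × ℝ → ℝ) (x : Fin N → EuclideanSpace ℝ (Fin d)) (y : Fin N → ℝ)
    (θ : Params H d) (t : Fin H → Fin N → ℝ) : Params H d :=
  mk (fun k => ∑ i, rho ℓ x y θ i * max (inner ℝ (w θ k) (x i)) 0)
    (fun k => ∑ i, (u θ k * rho ℓ x y θ i * t k i) • x i)

/-- The `0`-`1` gate values of a family of sets of inputs. -/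
def gate (e : Fin H → Set (Fin N)) (k : Fin H) (i : Fin N) : ℝ := (e k).indicator 1 i

theorem gate_of_mem {e : Fin H → Set (Fin N)} {k : Fin H} {i : Fin N} (h : i ∈ e k) :
    gate e k i = 1 := indicator_of_mem h _

theorem gate_of_notMem {e : Fin H → Set (Fin N)} {k : Fin H} {i : Fin N} (h : i ∉ e k) :
    gate e k i = 0 := indicator_of_notMem h _

/-- The loss of the network in which the gates are frozen to the values `t`. -/
def gatedLoss (ℓ : ℝ × ℝ → ℝ) (x : Fin N → EuclideanSpace ℝ (Fin d)) (y : Fin N → ℝ)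
    (t : Fin H → Fin N → ℝ) (η : Params H d) : ℝ :=
  ∑ i, ℓ (∑ k, u η k * (t k i * inner ℝ (w η k) (x i)), y i)

theorem gate_mul_inner {e : Fin H → Set (Fin N)} {η : Params H d} (hη : η ∈ cell x e)
    (k : Fin H) (i : Fin N) :
    gate e k i * inner ℝ (w η k) (x i) = max (inner ℝ (w η k) (x i)) 0 := by
  by_cases hi : i ∈ e k
  · rw [gate_of_mem hi, one_mul, max_eq_left ((hη k i).1 hi)]
  · rw [gate_of_notMem hi, zero_mul, max_eq_right ((hη k i).2 hi)]

theorem gatedOutput_eq_output {e : Fin H → Set (Fin N)} {η : Params H d} (hη : η ∈ cell x e)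
    (i : Fin N) :
    ∑ k, u η k * (gate e k i * inner ℝ (w η k) (x i)) = output η (x i) :=
  Finset.sum_congr rfl fun k _ => by rw [gate_mul_inner hη]

theorem gatedLoss_eq_empiricalLoss {e : Fin H → Set (Fin N)} {η : Params H d}
    (hη : η ∈ cell x e) : gatedLoss ℓ x y (gate e) η = empiricalLoss ℓ x y η :=
  Finset.sum_congr rfl fun i _ => by rw [gatedOutput_eq_output hη]

/-- The closed cell suffices, boundary included: the frozen loss is differentiable everywhere, and
lying in the cell only serves to identify its outputs and gated pre-activations with the true ones.
-/
theorem hasGradientAt_gatedLoss (hℓ : Differentiable ℝ ℓ) {e : Fin H → Set (Fin N)}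
    {η : Params H d} (hη : η ∈ cell x e) :
    HasGradientAt (gatedLoss ℓ x y (gate e)) (gatedVector ℓ x y η (gate e)) η := by
  rw [hasGradientAt_iff_hasFDerivAt]
  have hout : ∀ i, HasFDerivAt
      (fun ξ : Params H d => ∑ k, u ξ k * (gate e k i * inner ℝ (w ξ k) (x i)))
      (∑ k, (u η k • (gate e k i • ((innerSL ℝ (x i)).comp (wCLM k))) +
        (gate e k i * inner ℝ (w η k) (x i)) • uCLM k)) η := by
    intro i
    refine HasFDerivAt.fun_sum fun k _ => ?_
    have h1 : HasFDerivAt (fun ξ : Params H d => u ξ k) (uCLM k) η := (uCLM k).hasFDerivAt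
    have h2 : HasFDerivAt (fun ξ : Params H d => (inner ℝ (w ξ k) (x i) : ℝ))
        ((innerSL ℝ (x i)).comp (wCLM k)) η := by
      have := ((innerSL ℝ (x i)).comp (wCLM (H := H) k)).hasFDerivAt (x := η)
      refine this.congr_of_eventuallyEq (Eventually.of_forall fun ξ => ?_)
      simp [wCLM_apply, real_inner_comm]
    exact h1.mul (h2.const_mul (gate e k i))
  have hder : ∀ i, HasFDerivAt
      (fun ξ : Params H d => ℓ (∑ k, u ξ k * (gate e k i * inner ℝ (w ξ k) (x i)), y i))
      (rho ℓ x y η i • ∑ k, (u η k • (gate e k i • ((innerSL ℝ (x i)).comp (wCLM k))) +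
        (gate e k i * inner ℝ (w η k) (x i)) • uCLM k)) η := by
    intro i
    have hd : DifferentiableAt ℝ (fun t => ℓ (t, y i)) (output η (x i)) := by
      have : Differentiable ℝ (fun t : ℝ => ℓ (t, y i)) := by fun_prop
      exact this _
    have h3 : HasDerivAt (fun t => ℓ (t, y i)) (rho ℓ x y η i)
        (∑ k, u η k * (gate e k i * inner ℝ (w η k) (x i))) := by
      rw [gatedOutput_eq_output hη]
      exact hd.hasDerivAt
    exact h3.comp_hasFDerivAt η (hout i)
  refine (HasFDerivAt.fun_sum fun i (_ : i ∈ Finset.univ) => hder i).congr_fderiv ?_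
  ext ξ
  simp only [sum_apply, smul_apply,
    add_apply, ContinuousLinearMap.comp_apply, InnerProductSpace.toDual_apply_apply,
    inner_params, gatedVector, u_mk, w_mk, uCLM_apply, wCLM_apply, innerSL_apply_apply, smul_eq_mul,
    sum_inner, inner_smul_left, conj_trivial, gate_mul_inner hη, Finset.mul_sum, Finset.sum_mul]
  rw [Finset.sum_comm]
  refine Finset.sum_congr rfl fun k _ => ?_
  rw [← Finset.sum_add_distrib]
  exact Finset.sum_congr rfl fun i _ => by ring

theorem nonempty_interior_cell {v : Fin H → EuclideanSpace ℝ (Fin d)}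
    (hv : ∀ k i, inner ℝ (v k) (x i) ≠ 0) (η : Params H d) :
    (interior (cell x (activeSet x η v))).Nonempty := by
  obtain ⟨t, ht⟩ := (eventually_mem_openCell η hv).exists
  exact ⟨_, interior_maximal (openCell_subset_cell _) (isOpen_openCell _) ht⟩

/-- At every point of differentiability the gradient of the loss is a gated vector. -/
theorem gradient_empiricalLoss_eq (hℓ : Differentiable ℝ ℓ)
    {v : Fin H → EuclideanSpace ℝ (Fin d)} (hv : ∀ k i, inner ℝ (v k) (x i) ≠ 0)
    {η : Params H d} (hη : DifferentiableAt ℝ (fun ξ : Params H d => empiricalLoss ℓ x y ξ) η) :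
    gradient (fun ξ : Params H d => empiricalLoss ℓ x y ξ) η =
      gatedVector ℓ x y η (gate (activeSet x η v)) := by
  have hmem := mem_cell_activeSet (x := x) η v
  exact hη.hasGradientAt.eq_of_eqOn_convex (hasGradientAt_gatedLoss hℓ hmem) (convex_cell _)
    (nonempty_interior_cell hv η) hmem fun ξ hξ => (gatedLoss_eq_empiricalLoss hξ).symm

theorem hasGradientAt_empiricalLoss (hℓ : Differentiable ℝ ℓ) {e : Fin H → Set (Fin N)}
    {η : Params H d} (hη : η ∈ openCell x e) :
    HasGradientAt (fun ξ : Params H d => empiricalLoss ℓ x y ξ)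
      (gatedVector ℓ x y η (gate e)) η := by
  refine (hasGradientAt_gatedLoss hℓ (openCell_subset_cell e hη)).congr_of_eventuallyEq ?_
  filter_upwards [(isOpen_openCell e).mem_nhds hη] with ξ hξ
  exact (gatedLoss_eq_empiricalLoss (openCell_subset_cell e hξ)).symm

theorem continuous_rho (hℓ : Differentiable ℝ ℓ) (hℓ' : LocallyLipschitz (fderiv ℝ ℓ))
    (i : Fin N) : Continuous fun θ : Params H d => rho ℓ x y θ i := by
  have hd : ∀ t : ℝ, deriv (fun t => ℓ (t, y i)) t = fderiv ℝ ℓ (t, y i) (1, 0) := by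
    intro t
    have h1 : HasDerivAt (fun t : ℝ => (t, y i)) (1, 0) t :=
      (hasDerivAt_id t).prodMk (hasDerivAt_const t (y i))
    exact ((hℓ (t, y i)).hasFDerivAt.comp_hasDerivAt t h1).deriv
  have ho : Continuous fun θ : Params H d => output θ (x i) := by
    unfold output
    fun_prop
  simp only [rho, hd]
  exact (hℓ'.continuous.comp (ho.prodMk continuous_const)).clm_apply continuous_const

theorem continuous_gatedVector (hℓ : Differentiable ℝ ℓ) (hℓ' : LocallyLipschitz (fderiv ℝ ℓ))
    (t : Fin H → Fin N → ℝ) : Continuous fun θ : Params H d => gatedVector ℓ x y θ t := by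
  have hρ := fun i => continuous_rho (H := H) (x := x) (y := y) hℓ hℓ' i
  refine continuous_mk (fun k => ?_) fun k => ?_
  · fun_prop
  · fun_prop

/-- The limits of gradients of the loss at `θ` are the gated vectors of the active sets of generic
directions. -/
theorem exists_tendsto_gradient_iff (hℓ : Differentiable ℝ ℓ)
    (hℓ' : LocallyLipschitz (fderiv ℝ ℓ)) (hx : ∀ i, x i ≠ 0) (θ s : Params H d) :
    (∃ z : ℕ → Params H d, Tendsto z atTop (𝓝 θ) ∧
      (∀ n, DifferentiableAt ℝ (fun ξ : Params H d => empiricalLoss ℓ x y ξ) (z n)) ∧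
      Tendsto (fun n => gradient (fun ξ : Params H d => empiricalLoss ℓ x y ξ) (z n)) atTop
        (𝓝 s)) ↔
    ∃ v : Fin H → EuclideanSpace ℝ (Fin d), (∀ k i, inner ℝ (v k) (x i) ≠ 0) ∧
      gatedVector ℓ x y θ (gate (activeSet x θ v)) = s := by
  constructor
  · rintro ⟨z, hz, hdiff, hlim⟩
    obtain ⟨v, hv⟩ := exists_forall_inner_ne_zero x hx
    have hv' : ∀ (k : Fin H) i, inner ℝ ((fun _ : Fin H => v) k) (x i) ≠ 0 := fun _ => hv
    -- There are finitely many patterns, so one recurs infinitely often; continuity of the gated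
    -- vector then identifies the limit.
    obtain ⟨e, he⟩ : ∃ e, ∃ᶠ n in atTop, activeSet x (z n) (fun _ => v) = e := by
      by_contra! hne
      obtain ⟨n, hn⟩ := (eventually_all.2 hne).exists
      exact hn _ rfl
    have hs : gatedVector ℓ x y θ (gate e) = s := by
      refine (tendsto_nhds_unique_of_frequently_eq hlim
        (((continuous_gatedVector hℓ hℓ' (gate e)).tendsto θ).comp hz) ?_).symm
      refine he.mono fun n hn => ?_
      rw [gradient_empiricalLoss_eq hℓ hv' (hdiff n), hn]
      rfl
    -- `z n` may lie on a cell boundary. A small push along `v` enters the open cell of `e` while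
    -- staying near θ, and the inner weights of the pushed point are the generic direction sought.
    obtain ⟨n, hn, hn'⟩ := (he.and_eventually
      (hz.eventually (eventually_eq_activeSet (x := x) θ).eventually_nhds)).exists
    have hray : Tendsto (fun t : ℝ => z n + t • mk 0 (fun _ => v)) (𝓝[>] 0) (𝓝 (z n)) := by
      have : Continuous (fun t : ℝ => z n + t • mk 0 (fun _ => v)) := by fun_prop
      simpa using (this.tendsto 0).mono_left nhdsWithin_le_nhds
    obtain ⟨t, ht, ht'⟩ := ((eventually_mem_openCell (z n) hv').and
      (hray.eventually hn')).exists
    rw [hn] at ht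
    obtain ⟨h1, h2⟩ := ht' e ht
    exact ⟨_, h2, by rw [← h1, hs]⟩
  · rintro ⟨v, hv, rfl⟩
    have hray : Tendsto (fun t : ℝ => θ + t • mk 0 v) (𝓝[>] 0) (𝓝 θ) := by
      have : Continuous (fun t : ℝ => θ + t • mk 0 v) := by fun_prop
      simpa using (this.tendsto 0).mono_left nhdsWithin_le_nhds
    obtain ⟨t, ht, ht'⟩ := exists_seq_forall_of_frequently
      (l := 𝓝[>] (0 : ℝ)) (eventually_mem_openCell θ hv).frequently
    refine ⟨fun n => θ + t n • mk 0 v, hray.comp ht,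
      fun n => (hasGradientAt_empiricalLoss hℓ (ht' n)).differentiableAt, ?_⟩
    simp only [fun n => (hasGradientAt_empiricalLoss (y := y) hℓ (ht' n)).gradient]
    exact ((continuous_gatedVector hℓ hℓ' _).tendsto θ).comp (hray.comp ht)

end TwoLayerReLU

end

/-! ### Support functions and the comparison of the two sets -/

noncomputable section

/-- A vector lies in the convex hull of a finite set if in each direction it is dominated by an
element of the set. -/
theorem mem_convexHull_of_forall_exists_inner_le {F : Type*} [NormedAddCommGroup F]
    [InnerProductSpace ℝ F] [CompleteSpace F] {S : Set F} (hS : S.Finite) {g : F}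
    (h : ∀ δ, ∃ s ∈ S, inner ℝ g δ ≤ inner ℝ s δ) : g ∈ convexHull ℝ S := by
  by_contra hne
  obtain ⟨f, c, hf, hc⟩ := geometric_hahn_banach_closed_point (convex_convexHull ℝ _)
    (hS.isCompact_convexHull ℝ).isClosed hne
  obtain ⟨s, hs, hle⟩ := h ((InnerProductSpace.toDual ℝ F).symm f)
  rw [real_inner_comm, InnerProductSpace.toDual_symm_apply, real_inner_comm,
    InnerProductSpace.toDual_symm_apply] at hle
  exact (hle.trans_lt (hf _ (subset_convexHull ℝ _ hs))).not_gt hc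

namespace TwoLayerReLU

variable {N H d : ℕ} {ℓ : ℝ × ℝ → ℝ} {x : Fin N → EuclideanSpace ℝ (Fin d)} {y : Fin N → ℝ}

/-- Gate values in `[0, 1]` that are forced to `1` on active and to `0` on inactive inputs. -/
def IsGate (x : Fin N → EuclideanSpace ℝ (Fin d)) (a : EuclideanSpace ℝ (Fin d))
    (t : Fin N → ℝ) : Prop :=
  ∀ i, t i ∈ Icc (0 : ℝ) 1 ∧ (0 < inner ℝ a (x i) → t i = 1) ∧ (inner ℝ a (x i) < 0 → t i = 0)

/-- Off the kinks the gate is forced by the sign of the pre-activation; at a kink it is the free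
parameter of the segment. -/
theorem mem_GC_iff (θ : Params H d) (k : Fin H) (g : EuclideanSpace ℝ (Fin d)) :
    g ∈ GC ℓ x y θ k ↔ ∃ t : Fin N → ℝ, IsGate x (w θ k) t ∧
      ∑ i, (u θ k * rho ℓ x y θ i * t i) • x i = g := by
  classical
  have hsplit : ∀ t : Fin N → ℝ, ∑ i, (u θ k * rho ℓ x y θ i * t i) • x i =
      ∑ i with inner ℝ (w θ k) (x i) ≠ 0, (u θ k * rho ℓ x y θ i * t i) • x i +
      ∑ i with inner ℝ (w θ k) (x i) = 0, (u θ k * rho ℓ x y θ i * t i) • x i := by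
    intro t
    rw [add_comm]
    exact (Finset.sum_filter_add_sum_filter_not _ _ _).symm
  rw [GC, singleton_add, mem_image]
  constructor
  · rintro ⟨b, hb, rfl⟩
    obtain ⟨f, hf, rfl⟩ := (mem_finsetSum _ _ _).1 hb
    have hf' : ∀ i, ∃ t ∈ Icc (0 : ℝ) 1, inner ℝ (w θ k) (x i) = 0 →
        t • ((u θ k * rho ℓ x y θ i) • x i) = f i := by
      intro i
      by_cases hi : inner ℝ (w θ k) (x i) = 0
      · obtain ⟨t, ht, htf⟩ := hf (i := i) (by simpa using hi)
        exact ⟨t, ht, fun _ => htf⟩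
      · exact ⟨0, by simp, fun h => absurd h hi⟩
    choose t ht htf using hf'
    refine ⟨fun i => if inner ℝ (w θ k) (x i) = 0 then t i else
      if 0 < inner ℝ (w θ k) (x i) then 1 else 0, fun i => ?_, ?_⟩
    · dsimp only
      split_ifs with h h'
      · exact ⟨ht i, fun h' => absurd h h'.ne', fun h' => absurd h h'.ne⟩
      · exact ⟨by simp, fun _ => rfl, fun h'' => absurd h' h''.not_gt⟩
      · exact ⟨by simp, fun h'' => absurd h'' h', fun _ => rfl⟩
    · rw [hsplit]
      congr 1
      · refine Finset.sum_congr rfl fun i hi => ?_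
        rw [if_neg (Finset.mem_filter.1 hi).2]
      · refine Finset.sum_congr rfl fun i hi => ?_
        rw [if_pos (Finset.mem_filter.1 hi).2, ← htf i (Finset.mem_filter.1 hi).2, smul_smul, mul_comm]
  · rintro ⟨t, ht, rfl⟩
    refine ⟨∑ i with inner ℝ (w θ k) (x i) = 0, (u θ k * rho ℓ x y θ i * t i) • x i,
      (mem_finsetSum _ _ _).2 ⟨fun i => (u θ k * rho ℓ x y θ i * t i) • x i, fun {i} _ => ?_, rfl⟩, ?_⟩
    · exact ⟨t i, (ht i).1, by simp only [smul_smul]; rw [mul_comm]⟩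
    · rw [hsplit]
      congr 1
      refine Finset.sum_congr rfl fun i hi => ?_
      rcases lt_or_gt_of_ne (Finset.mem_filter.1 hi).2 with h | h
      · rw [if_neg h.not_gt, (ht i).2.2 h]
      · rw [if_pos h, (ht i).2.1 h]

/-- Brings the chain rule set to the form of the limiting gradients, so that only the admissible
gates differ. -/
theorem mem_chainRuleSet_iff (θ g : Params H d) :
    g ∈ chainRuleSet ℓ x y θ ↔
      ∃ t : Fin H → Fin N → ℝ, (∀ k, IsGate x (w θ k) (t k)) ∧ gatedVector ℓ x y θ t = g := by
  simp only [chainRuleSet, mem_ofPred_eq, mem_GC_iff]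
  constructor
  · intro h
    choose hu t ht hw using h
    exact ⟨t, ht, params_ext (fun k => (hu k).symm) hw⟩
  · rintro ⟨t, ht, rfl⟩ k
    exact ⟨rfl, t k, ht k, rfl⟩

theorem convex_chainRuleSet (θ : Params H d) : Convex ℝ (chainRuleSet ℓ x y θ) := by
  intro g hg g' hg' a b ha hb hab
  obtain ⟨t, ht, rfl⟩ := (mem_chainRuleSet_iff θ g).1 hg
  obtain ⟨s, hs, rfl⟩ := (mem_chainRuleSet_iff θ g').1 hg'
  refine (mem_chainRuleSet_iff θ _).2
    ⟨fun k i => a * t k i + b * s k i, fun k i => ⟨?_, fun h => ?_, fun h => ?_⟩, ?_⟩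
  · exact convex_Icc (0 : ℝ) 1 (ht k i).1 (hs k i).1 ha hb hab
  · simp only [(ht k i).2.1 h, (hs k i).2.1 h]; linarith
  · simp [(ht k i).2.2 h, (hs k i).2.2 h]
  · refine params_ext (fun k => ?_) fun k => ?_
    · simp only [u_add, u_smul, gatedVector, u_mk]
      rw [← add_mul, hab, one_mul]
    · simp only [w_add, w_smul, gatedVector, w_mk, Finset.smul_sum, smul_smul]
      rw [← Finset.sum_add_distrib]
      refine Finset.sum_congr rfl fun i _ => ?_
      rw [← add_smul]
      ring_nf

theorem isGate_gate {θ : Params H d} {e : Fin H → Set (Fin N)} {k : Fin H}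
    (h : ∀ i, (0 < inner ℝ (w θ k) (x i) → i ∈ e k) ∧ (inner ℝ (w θ k) (x i) < 0 → i ∉ e k)) :
    IsGate x (w θ k) (gate e k) := by
  intro i
  refine ⟨?_, fun hi => gate_of_mem ((h i).1 hi), fun hi => gate_of_notMem ((h i).2 hi)⟩
  by_cases hi : i ∈ e k
  · simp [gate_of_mem hi]
  · simp [gate_of_notMem hi]

theorem isGate_activeSet (θ : Params H d) (v : Fin H → EuclideanSpace ℝ (Fin d)) (k : Fin H) :
    IsGate x (w θ k) (gate (activeSet x θ v) k) :=
  isGate_gate fun _ => ⟨Or.inl, fun h h' => h'.elim h.not_gt fun h' => h.ne h'.1⟩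

theorem clarkeSubdifferential_empiricalLoss (hℓ : Differentiable ℝ ℓ)
    (hℓ' : LocallyLipschitz (fderiv ℝ ℓ)) (hx : ∀ i, x i ≠ 0) (θ : Params H d) :
    clarkeSubdifferential (fun η : Params H d => empiricalLoss ℓ x y η) θ =
      convexHull ℝ ((fun v => gatedVector ℓ x y θ (gate (activeSet x θ v))) ''
        {v | ∀ k i, inner ℝ (v k) (x i) ≠ 0}) := by
  rw [clarkeSubdifferential]
  congr 1
  ext s
  exact exists_tendsto_gradient_iff hℓ hℓ' hx θ s

theorem finite_gatedVectors (θ : Params H d) (S : Set (Fin H → EuclideanSpace ℝ (Fin d))) :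
    ((fun v => gatedVector ℓ x y θ (gate (activeSet x θ v))) '' S).Finite := by
  refine (finite_range fun e : Fin H → Set (Fin N) => gatedVector ℓ x y θ (gate e)).subset ?_
  rintro _ ⟨v, -, rfl⟩
  exact ⟨_, rfl⟩

theorem inner_gatedVector (θ δ : Params H d) (t : Fin H → Fin N → ℝ) :
    inner ℝ (gatedVector ℓ x y θ t) δ =
      ∑ k, ((∑ i, rho ℓ x y θ i * max (inner ℝ (w θ k) (x i)) 0) * u δ k +
        ∑ i, u θ k * rho ℓ x y θ i * t k i * inner ℝ (w δ k) (x i)) := by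
  rw [inner_params]
  refine Finset.sum_congr rfl fun k _ => ?_
  simp only [gatedVector, u_mk, w_mk, sum_inner, inner_smul_left, conj_trivial,
    real_inner_comm (x _)]

/-- Under Span Qualification, each support value of the chain rule set is attained at a limit of
gradients. -/
theorem SpanQualification.exists_inner_le (hx : ∀ i, x i ≠ 0) {θ : Params H d}
    (h : SpanQualification ℓ x y θ) (δ : Params H d) {t : Fin H → Fin N → ℝ}
    (ht : ∀ k, IsGate x (w θ k) (t k)) :
    ∃ v : Fin H → EuclideanSpace ℝ (Fin d), (∀ k i, inner ℝ (v k) (x i) ≠ 0) ∧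
      inner ℝ (gatedVector ℓ x y θ t) δ ≤
        inner ℝ (gatedVector ℓ x y θ (gate (activeSet x θ v))) δ := by
  -- `v' k` has the signs of `u_k ρᵢ · inner ℝ (w δ k) (x i)` at the kinks, so its gates maximize
  -- each term separately; the generic perturbation changes gates only where the term vanishes.
  choose v' hP hQ using fun k => exists_inner_eq_and_inner_eq_neg (h k) (w δ k)
  choose v hv using fun k => exists_generic_same_sign x hx (v' k)
  refine ⟨v, fun k i => (hv k i).1, ?_⟩
  rw [inner_gatedVector, inner_gatedVector]
  refine Finset.sum_le_sum fun k _ => add_le_add_right (Finset.sum_le_sum fun i _ => ?_) _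
  have hg := isGate_activeSet (x := x) θ v k i
  rcases lt_trichotomy (inner ℝ (w θ k) (x i) : ℝ) 0 with h0 | h0 | h0
  · rw [(ht k i).2.2 h0, hg.2.2 h0]
  · obtain ⟨ht0, ht1⟩ := (ht k i).1
    have hact : 0 < inner ℝ (v k) (x i) → gate (activeSet x θ v) k i = 1 :=
      fun hi => gate_of_mem (Or.inr ⟨h0, hi⟩)
    have hinact : inner ℝ (v k) (x i) < 0 → gate (activeSet x θ v) k i = 0 :=
      fun hi => gate_of_notMem fun h' => h'.elim (fun h' => h'.ne' h0) fun h' => hi.not_gt h'.2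
    have hsgn := (hv k i).2
    rcases lt_trichotomy (u θ k * rho ℓ x y θ i) 0 with hc | hc | hc
    · rw [hQ k _ ⟨i, ⟨h0, hc⟩, rfl⟩] at hsgn
      rcases lt_trichotomy (inner ℝ (w δ k) (x i) : ℝ) 0 with hd | hd | hd
      · rw [hact (hsgn.1 (by linarith))]
        nlinarith [mul_pos_of_neg_of_neg hc hd]
      · simp [hd]
      · rw [hinact (hsgn.2 (by linarith))]
        nlinarith [mul_neg_of_neg_of_pos hc hd]
    · simp [hc]
    · rw [hP k _ ⟨i, ⟨h0, hc⟩, rfl⟩] at hsgn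
      rcases lt_trichotomy (inner ℝ (w δ k) (x i) : ℝ) 0 with hd | hd | hd
      · rw [hinact (hsgn.2 hd)]
        nlinarith [mul_neg_of_pos_of_neg hc hd]
      · simp [hd]
      · rw [hact (hsgn.1 hd)]
        nlinarith [mul_pos hc hd]
  · rw [(ht k i).2.1 h0, hg.2.1 h0]

theorem chainRuleSet_subset_convexHull (hx : ∀ i, x i ≠ 0) {θ : Params H d}
    (h : SpanQualification ℓ x y θ) :
    chainRuleSet ℓ x y θ ⊆
      convexHull ℝ ((fun v => gatedVector ℓ x y θ (gate (activeSet x θ v))) ''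
        {v | ∀ k i, inner ℝ (v k) (x i) ≠ 0}) := by
  intro g hg
  obtain ⟨t, ht, rfl⟩ := (mem_chainRuleSet_iff θ g).1 hg
  refine mem_convexHull_of_forall_exists_inner_le (finite_gatedVectors θ _) fun δ => ?_
  obtain ⟨v, hv, hle⟩ := h.exists_inner_le hx δ ht
  exact ⟨_, ⟨v, hv, rfl⟩, hle⟩

/-- If the limits of gradients generate the chain rule set, Span Qualification holds. -/
theorem spanQualification_of_chainRuleSet_subset {θ : Params H d}
    (h : chainRuleSet ℓ x y θ ⊆
      convexHull ℝ ((fun v => gatedVector ℓ x y θ (gate (activeSet x θ v))) ''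
        {v | ∀ k i, inner ℝ (v k) (x i) ≠ 0})) : SpanQualification ℓ x y θ := by
  intro k
  refine span_inf_span_eq_bot_of_exists_sign_flip fun v => ?_
  -- These gates maximize the functional `φ` below, which pairs block `k` with `v`; the other blocks
  -- play no role.
  let best : Fin H → Set (Fin N) := fun k => {i | 0 < inner ℝ (w θ k) (x i) ∨
    inner ℝ (w θ k) (x i) = 0 ∧ 0 < u θ k * rho ℓ x y θ i * inner ℝ v (x i)}
  have hbest : ∀ k, IsGate x (w θ k) (gate best k) := fun k =>
    isGate_gate fun _ => ⟨Or.inl, fun h h' => h'.elim h.not_gt fun h' => h.ne h'.1⟩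
  let φ : Params H d →L[ℝ] ℝ := (innerSL ℝ v).comp (wCLM k)
  have hφ : ∀ t, φ (gatedVector ℓ x y θ t) =
      ∑ i, u θ k * rho ℓ x y θ i * t k i * inner ℝ v (x i) := by
    intro t
    simp only [φ, ContinuousLinearMap.comp_apply, wCLM_apply, innerSL_apply_apply, gatedVector,
      w_mk, inner_sum, inner_smul_right]
  obtain ⟨v', hv', hle⟩ : ∃ v' : Fin H → EuclideanSpace ℝ (Fin d),
      (∀ k i, inner ℝ (v' k) (x i) ≠ 0) ∧
      φ (gatedVector ℓ x y θ (gate best)) ≤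
        φ (gatedVector ℓ x y θ (gate (activeSet x θ v'))) := by
    -- Otherwise the whole hull would lie in an open half-space that omits the maximizer.
    by_contra! hlt
    have hsub := convexHull_min (𝕜 := ℝ) (t := {g | φ g < φ (gatedVector ℓ x y θ (gate best))})
      (image_subset_iff.2 fun v' hv' => hlt v' hv')
      (convex_halfSpace_lt φ.isLinear _)
    exact lt_irrefl (φ (gatedVector ℓ x y θ (gate best)))
      (hsub (h ((mem_chainRuleSet_iff θ _).2 ⟨gate best, hbest, rfl⟩)))
  rw [hφ, hφ] at hle
  have hterm : ∀ i, u θ k * rho ℓ x y θ i * gate (activeSet x θ v') k i * inner ℝ v (x i) ≤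
      u θ k * rho ℓ x y θ i * gate best k i * inner ℝ v (x i) := by
    intro i
    have hg := isGate_activeSet (x := x) θ v' k i
    rcases lt_trichotomy (inner ℝ (w θ k) (x i) : ℝ) 0 with h0 | h0 | h0
    · rw [(hbest k i).2.2 h0, hg.2.2 h0]
    · obtain ⟨hg0, hg1⟩ := hg.1
      by_cases hi : i ∈ best k
      · rw [gate_of_mem hi]
        have := (hi.resolve_left fun h' => h'.ne' h0).2
        nlinarith
      · rw [gate_of_notMem hi]
        have : u θ k * rho ℓ x y θ i * inner ℝ v (x i) ≤ 0 :=
          not_lt.1 fun h' => hi (Or.inr ⟨h0, h'⟩)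
        nlinarith
    · rw [(hbest k i).2.1 h0, hg.2.1 h0]
  -- Each term is at most its best value while the sum attains the maximum, so all terms agree;
  -- wherever the coefficient is nonzero this fixes the gate, hence the sign of `inner ℝ (v' k) (x
  -- i)`.
  have heq := (Finset.sum_eq_sum_iff_of_le fun i _ => hterm i).1
    (le_antisymm (Finset.sum_le_sum fun i _ => hterm i) hle)
  have hmem : ∀ i, inner ℝ (w θ k) (x i) = 0 → u θ k * rho ℓ x y θ i * inner ℝ v (x i) ≠ 0 →
      (0 < inner ℝ (v' k) (x i) ↔ 0 < u θ k * rho ℓ x y θ i * inner ℝ v (x i)) := by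
    intro i h0 hne
    have hi := heq i (Finset.mem_univ i)
    have hgate : gate (activeSet x θ v') k i = gate best k i := by
      refine mul_left_cancel₀ hne ?_
      linarith
    have h1 : i ∈ activeSet x θ v' k ↔ 0 < inner ℝ (v' k) (x i) := by
      simp [activeSet, h0]
    have h2 : i ∈ best k ↔ 0 < u θ k * rho ℓ x y θ i * inner ℝ v (x i) := by
      simp [best, h0]
    rw [← h1, ← h2]
    by_cases ha : i ∈ activeSet x θ v' k <;> by_cases hb : i ∈ best k <;>
      simp_all [gate]
  refine ⟨v' k, ?_, ?_⟩
  · rintro _ ⟨i, ⟨h0, hc⟩, rfl⟩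
    refine ⟨fun hv => ?_, fun hv => ?_⟩
    · have := mul_pos hc hv
      exact ((hmem i h0 this.ne').2 this).le
    · have := mul_neg_of_pos_of_neg hc hv
      exact not_lt.1 fun h' => this.not_gt ((hmem i h0 this.ne).1 h')
  · rintro _ ⟨i, ⟨h0, hc⟩, rfl⟩
    refine ⟨fun hv => ?_, fun hv => ?_⟩
    · have := mul_neg_of_neg_of_pos hc hv
      exact lt_of_le_of_ne (not_lt.1 fun h' => this.not_gt ((hmem i h0 this.ne).1 h')) (hv' k i)
    · have := mul_pos_of_neg_of_neg hc hv
      exact (hmem i h0 this.ne').2 this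

end TwoLayerReLU

end

theorem theorem2 {N H d : ℕ} (ℓ : ℝ × ℝ → ℝ) (hℓ : Differentiable ℝ ℓ)
    (hℓ' : LocallyLipschitz (fderiv ℝ ℓ))
    (x : Fin N → EuclideanSpace ℝ (Fin d)) (y : Fin N → ℝ) (hx : ∀ i, x i ≠ 0)
    (θ : TwoLayerReLU.Params H d) :
    clarkeSubdifferential (fun η : TwoLayerReLU.Params H d => TwoLayerReLU.empiricalLoss ℓ x y η) θ
        = TwoLayerReLU.chainRuleSet ℓ x y θ ↔
      TwoLayerReLU.SpanQualification ℓ x y θ := by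
  rw [TwoLayerReLU.clarkeSubdifferential_empiricalLoss hℓ hℓ' hx]
  refine ⟨fun h => TwoLayerReLU.spanQualification_of_chainRuleSet_subset h.ge, fun h => ?_⟩
  -- This inclusion needs no qualification: the gates of active sets are admissible and the chain
  -- rule set is convex.
  refine (convexHull_min ?_ (TwoLayerReLU.convex_chainRuleSet θ)).antisymm
    (TwoLayerReLU.chainRuleSet_subset_convexHull hx h)
  rintro _ ⟨v, -, rfl⟩
  exact (TwoLayerReLU.mem_chainRuleSet_iff θ _).2
    ⟨_, TwoLayerReLU.isGate_activeSet θ v, rfl⟩
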